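/- **Corollary 1.2.** Let $r,m,n\ge 2$ be integers. Let $G$ be the $m\times n$ grid, i.e. the graph with vertex set $\{1,\dots,m\}\times\{1,\dots,n\}$ in which two vertices are adjacent if and only if they agree in one coordinate and differ by exactly $1$ in the other. Let $$\mathcal{D}_r(G,\mathcal{T})=\min_{f:E(G)\to\{1,\dots,r\}}\ \max_{S}\ \max_{1\le j\le r}\Bigl(r\,\bigl|f^{-1}(j)\cap E(S)\bigr|-|E(S)|\Bigr),$$ where the minimum is over all $r$-colourings $f$ of the edges of $G$ and $S$ ranges over all subgraphs of $G$ that are trees (not necessarily spanning). Then $$\mathcal{D}_r(G,\mathcal{T})\ \ge\ \frac{r-1}{4r}\,mn+1-2r .$$ -/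

import Mathlib

universe u

namespace Hypergraph

variable {V : Type u}

/-- The imbalance `r |f⁻¹(j) ∩ A| - |A|` of the set `A` in the colour `j` under the
`r`-colouring `f` of the vertices of `H`. -/
noncomputable def imbalance {H : Hypergraph V} {r : ℕ} (f : H.vertexSet → Fin r) (A : Set V)
    (j : Fin r) : ℤ :=
  (r : ℤ) * ({a : H.vertexSet | f a = j ∧ (a : V) ∈ A}.ncard : ℤ) - (A.ncard : ℤ)

/-- The (upper) `r`-colour discrepancy of a finite hypergraph:
`min_{f : V(H) → [r]} max_{A ∈ E(H)} max_{j ∈ [r]} (r |f⁻¹(j) ∩ A| - |A|)`.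
If `r ≥ 1` and there is a hyperedge, the infimum and the suprema are over nonempty finite sets of
integers, hence are a minimum and maxima; see `isLeast_discrepancy` below. -/
noncomputable def discrepancy [Finite V] (H : Hypergraph V) (r : ℕ) : ℤ :=
  ⨅ f : H.vertexSet → Fin r, ⨆ A : H.edgeSet, ⨆ j : Fin r, imbalance f (A : Set V) j

/-- The innermost suprema in the definition of the discrepancy are maxima. -/
theorem isGreatest_imbalance [Finite V] (H : Hypergraph V) {r : ℕ} (hr : 1 ≤ r)
    (hH : H.edgeSet.Nonempty) (f : H.vertexSet → Fin r) :
    IsGreatest {x : ℤ | ∃ A ∈ H.edgeSet, ∃ j : Fin r, x = imbalance f A j}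
      (⨆ A : H.edgeSet, ⨆ j : Fin r, imbalance f (A : Set V) j) := by
  have : Nonempty (Fin r) := ⟨⟨0, hr⟩⟩
  have : Nonempty H.edgeSet := hH.to_subtype
  constructor
  · obtain ⟨A, hA⟩ := exists_eq_ciSup_of_finite
      (f := fun A : H.edgeSet => ⨆ j : Fin r, imbalance f (A : Set V) j)
    obtain ⟨j, hj⟩ := exists_eq_ciSup_of_finite (f := fun j : Fin r => imbalance f (A : Set V) j)
    exact ⟨A, A.2, j, by rw [← hA, ← hj]⟩
  · rintro x ⟨A, hA, j, rfl⟩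
    exact (le_ciSup (Set.finite_range fun j : Fin r => imbalance f A j).bddAbove j).trans
      (le_ciSup (Set.finite_range fun A : H.edgeSet =>
        ⨆ j : Fin r, imbalance f (A : Set V) j).bddAbove ⟨A, hA⟩)

/-- The discrepancy is the least, over all colourings, maximum imbalance. -/
theorem isLeast_discrepancy [Finite V] (H : Hypergraph V) {r : ℕ} (hr : 1 ≤ r)
    (hH : H.edgeSet.Nonempty) :
    IsLeast {x : ℤ | ∃ f : H.vertexSet → Fin r,
      IsGreatest {y : ℤ | ∃ A ∈ H.edgeSet, ∃ j : Fin r, y = imbalance f A j} x}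
      (H.discrepancy r) := by
  have : Nonempty (Fin r) := ⟨⟨0, hr⟩⟩
  constructor
  · obtain ⟨f, hf⟩ := exists_eq_ciInf_of_finite
      (f := fun f : H.vertexSet → Fin r => ⨆ A : H.edgeSet, ⨆ j : Fin r, imbalance f (A : Set V) j)
    exact ⟨f, by rw [discrepancy, ← hf]; exact isGreatest_imbalance H hr hH f⟩
  · rintro x ⟨f, hf⟩
    rw [hf.unique (isGreatest_imbalance H hr hH f)]
    exact ciInf_le (Set.finite_range fun f : H.vertexSet → Fin r =>
      ⨆ A : H.edgeSet, ⨆ j : Fin r, imbalance f (A : Set V) j).bddBelow f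

end Hypergraph

/-- The hypergraph of a family `X` of graphs in a base graph `G`: its vertices are the edges of `G`,
its hyperedges are the edge sets of the subgraphs of `G` that belong to `X`. -/
def copiesHypergraph {V : Type u} (G : SimpleGraph V) (X : ∀ W : Type u, SimpleGraph W → Prop) :
    Hypergraph (Sym2 V) where
  vertexSet := G.edgeSet
  edgeSet := {A | ∃ S : G.Subgraph, X S.verts S.coe ∧ A = S.edgeSet}
  subset_vertexSet_of_mem_edgeSet' := by
    rintro A ⟨S, -, rfl⟩
    exact S.edgeSet_subset

/-- The `r`-colour discrepancy of the family `X` in the graph `G`. -/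
noncomputable def graphDiscrepancy {V : Type u} [Finite V] (r : ℕ) (G : SimpleGraph V)
    (X : ∀ W : Type u, SimpleGraph W → Prop) : ℤ :=
  (copiesHypergraph G X).discrepancy r

/-- The family of all trees. -/
def allTrees : ∀ W : Type u, SimpleGraph W → Prop :=
  fun _ T => T.IsTree

/-- The `m × n` grid: the Cartesian (box) product of the paths on `m` and on `n` vertices. -/
def gridGraph (m n : ℕ) : SimpleGraph (Fin m × Fin n) :=
  (SimpleGraph.pathGraph m).boxProd (SimpleGraph.pathGraph n)

/-! Fix a colouring and a rooted spanning tree with leaf set `L`. For each colour `j`, prune the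
leaves whose edge is not coloured `j`. Summed over the `r` colours, the imbalances of these subtrees
total exactly `(r - 1) * L.card`, so `r` times the discrepancy is at least that
(`IsParentMap.mul_card_leaves_le`). In the grid, a comb has at least `(m / 2) * (n - 1) ≥ mn / 4 -
1` leaves (`le_card_gridLeaves`), which is more than enough. -/

section ParentMap

variable {V : Type u}

/-- A parent map `p` on a graph with a distinguished root: every vertex other than the root is
adjacent to its parent, and passing to the parent decreases the height `ρ`. -/
structure IsParentMap (G : SimpleGraph V) (root : V) (p : V → V) (ρ : V → ℕ) : Prop where
  adj : ∀ v, v ≠ root → G.Adj v (p v)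
  lt : ∀ v, v ≠ root → ρ (p v) < ρ v

/-! ### Trees encoded by parent maps -/

namespace IsParentMap

variable {G : SimpleGraph V} {root : V} {p : V → V} {ρ : V → ℕ}

/-- Two distinct vertices with the same edge would be each other's parents, against the descent of
`ρ`. Edges can thus be counted by their lower ends. -/
theorem injOn_edge (h : IsParentMap G root p ρ) :
    Set.InjOn (fun v => s(v, p v)) {v | v ≠ root} := by
  intro v hv w hw hvw
  rcases Sym2.eq_iff.1 hvw with ⟨h1, -⟩ | ⟨h1, h2⟩
  · exact h1
  · have a := h.lt v hv
    have b := h.lt w hw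
    rw [h2] at a
    rw [← h1] at b
    omega

/-- A graph all of whose edges join a vertex to its parent is a tree. -/
theorem isTree [Finite V] (h : IsParentMap G root p ρ)
    (hG : ∀ v w, G.Adj v w → (v ≠ root ∧ p v = w) ∨ (w ≠ root ∧ p w = v)) : G.IsTree := by
  rw [SimpleGraph.isTree_iff_connected_and_card]
  constructor
  · have reach : ∀ k v, ρ v ≤ k → G.Reachable v root := by
      intro k
      induction k with
      | zero =>
        intro v hv
        by_cases hvr : v = root
        · rw [hvr]
        · have := h.lt v hvr
          omega
      | succ k ih =>
        intro v hv
        by_cases hvr : v = root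
        · rw [hvr]
        · have := h.lt v hvr
          exact (h.adj v hvr).reachable.trans (ih _ (by omega))
    have : Nonempty V := ⟨root⟩
    exact ⟨fun v w => (reach _ v le_rfl).trans (reach _ w le_rfl).symm⟩
  · have hE : G.edgeSet = (fun v => s(v, p v)) '' {v | v ≠ root} := by
      ext e
      induction e using Sym2.ind with
      | _ v w =>
        simp only [SimpleGraph.mem_edgeSet, Set.mem_image, Set.mem_ofPred_eq]
        constructor
        · intro hvw
          rcases hG v w hvw with ⟨hv, rfl⟩ | ⟨hw, rfl⟩
          · exact ⟨v, hv, rfl⟩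
          · exact ⟨w, hw, Sym2.eq_swap⟩
        · rintro ⟨x, hx, hxe⟩
          rw [← SimpleGraph.mem_edgeSet, ← hxe]
          exact h.adj x hx
    rw [Nat.card_coe_set_eq, hE, h.injOn_edge.ncard_image]
    have hc : ({v | v ≠ root} : Set V) = {root}ᶜ := rfl
    have := Set.ncard_add_ncard_compl ({root} : Set V)
    rw [Set.ncard_singleton] at this
    rw [hc]
    omega

/-- The subgraph on a set of vertices whose edges join the vertices to their parents. -/
def subgraph (h : IsParentMap G root p ρ) (W : Set V) (hW : ∀ v ∈ W, v ≠ root → p v ∈ W) :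
    G.Subgraph where
  verts := W
  Adj v w := (v ∈ W ∧ v ≠ root ∧ p v = w) ∨ (w ∈ W ∧ w ≠ root ∧ p w = v)
  adj_sub := by
    rintro v w (⟨-, hv, rfl⟩ | ⟨-, hw, rfl⟩)
    · exact h.adj v hv
    · exact (h.adj w hw).symm
  edge_vert := by
    rintro v w (⟨hv, -, -⟩ | ⟨hw, hw', rfl⟩)
    · exact hv
    · exact hW w hw hw'
  symm := ⟨fun _ _ => Or.symm⟩

theorem isTree_subgraph [Finite V] (h : IsParentMap G root p ρ) (W : Set V)
    (hW : ∀ v ∈ W, v ≠ root → p v ∈ W) (hroot : root ∈ W) : (h.subgraph W hW).coe.IsTree := by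
  classical
  let q : W → W := fun v => if hv : (v : V) = root then v else ⟨p v, hW v v.2 hv⟩
  have hq : ∀ v : W, (v : V) ≠ root → (q v : V) = p v := fun v hv => by simp [q, hv]
  have hne : ∀ v : W, v ≠ ⟨root, hroot⟩ ↔ (v : V) ≠ root := fun v => by
    rw [Ne, Subtype.ext_iff]
  have hpar : IsParentMap (h.subgraph W hW).coe ⟨root, hroot⟩ q (fun v => ρ v) := by
    constructor
    · intro v hv
      replace hv := (hne v).1 hv
      exact Or.inl ⟨v.2, hv, (hq v hv).symm⟩
    · intro v hv
      replace hv := (hne v).1 hv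
      simpa only [hq v hv] using h.lt v hv
  have : Finite (h.subgraph W hW).verts := Subtype.finite
  refine hpar.isTree ?_
  rintro v w (⟨-, hv, hvw⟩ | ⟨-, hw, hwv⟩)
  · exact Or.inl ⟨(hne v).2 hv, Subtype.ext ((hq v hv).trans hvw)⟩
  · exact Or.inr ⟨(hne w).2 hw, Subtype.ext ((hq w hw).trans hwv)⟩

theorem edgeSet_subgraph (h : IsParentMap G root p ρ) (W : Set V)
    (hW : ∀ v ∈ W, v ≠ root → p v ∈ W) :
    (h.subgraph W hW).edgeSet = (fun v => s(v, p v)) '' {v | v ∈ W ∧ v ≠ root} := by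
  ext e
  induction e using Sym2.ind with
  | _ v w =>
    simp only [SimpleGraph.Subgraph.mem_edgeSet, Set.mem_image, Set.mem_ofPred_eq]
    constructor
    · rintro (⟨hv, hv', rfl⟩ | ⟨hw, hw', rfl⟩)
      · exact ⟨v, ⟨hv, hv'⟩, rfl⟩
      · exact ⟨w, ⟨hw, hw'⟩, Sym2.eq_swap⟩
    · rintro ⟨x, ⟨hx, hx'⟩, hxe⟩
      rw [← SimpleGraph.Subgraph.mem_edgeSet, ← hxe]
      exact Or.inl ⟨hx, hx', rfl⟩

/-- Each edge passes its colour to its child endpoint, turning edge counts into vertex counts. -/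
theorem imbalance_subgraph [Finite V] (h : IsParentMap G root p ρ)
    {X : ∀ W : Type u, SimpleGraph W → Prop} {r : ℕ}
    (f : (copiesHypergraph G X).vertexSet → Fin r) (c : V → Fin r)
    (hc : ∀ v (hv : v ≠ root), f ⟨s(v, p v), h.adj v hv⟩ = c v) (W : Set V)
    (hW : ∀ v ∈ W, v ≠ root → p v ∈ W) (j : Fin r) :
    Hypergraph.imbalance f (h.subgraph W hW).edgeSet j =
      r * ({v | v ∈ W ∧ v ≠ root ∧ c v = j}.ncard : ℤ) - ({v | v ∈ W ∧ v ≠ root}.ncard : ℤ) := by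
  have hE := h.edgeSet_subgraph W hW
  have h1 : (h.subgraph W hW).edgeSet.ncard = {v | v ∈ W ∧ v ≠ root}.ncard := by
    rw [hE]
    exact (h.injOn_edge.mono fun v hv => hv.2).ncard_image
  have himage : Subtype.val '' {a : (copiesHypergraph G X).vertexSet |
        f a = j ∧ (a : Sym2 V) ∈ (h.subgraph W hW).edgeSet} =
      (fun v => s(v, p v)) '' {v | v ∈ W ∧ v ≠ root ∧ c v = j} := by
    ext e
    constructor
    · rintro ⟨⟨_, he⟩, ⟨hf, hS⟩, rfl⟩
      rw [hE] at hS
      obtain ⟨v, ⟨hv, hv'⟩, rfl⟩ := hS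
      exact ⟨v, ⟨hv, hv', (hc v hv').symm.trans hf⟩, rfl⟩
    · rintro ⟨v, ⟨hv, hv', hj⟩, rfl⟩
      exact ⟨⟨s(v, p v), h.adj v hv'⟩,
        ⟨(hc v hv').trans hj, by rw [hE]; exact ⟨v, ⟨hv, hv'⟩, rfl⟩⟩, rfl⟩
  have h2 := congrArg Set.ncard himage
  rw [Set.ncard_image_of_injective _ Subtype.val_injective,
    (h.injOn_edge.mono fun v hv => hv.2.1).ncard_image] at h2
  rw [Hypergraph.imbalance, h1, h2]

end IsParentMap

/-- The tree discrepancy is at least `(r - 1) / r` times the number of leaves of a rooted spanning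
tree: averaging over the colours `j`, delete the leaves whose edge does not have the colour `j`. -/
theorem IsParentMap.mul_card_leaves_le [Fintype V] {G : SimpleGraph V} {root : V} {p : V → V}
    {ρ : V → ℕ} (h : IsParentMap G root p ρ) {r : ℕ} (hr : 1 ≤ r) (L : Finset V)
    (hroot : root ∉ L) (hL : ∀ v, v ≠ root → p v ∉ L) :
    ((r : ℤ) - 1) * (L.card : ℤ) ≤ r * graphDiscrepancy r G allTrees := by
  classical
  have hone : (copiesHypergraph G allTrees).edgeSet.Nonempty :=
    ⟨_, h.subgraph {root} (fun v hv hv' => absurd hv hv'), h.isTree_subgraph _ _ rfl, rfl⟩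
  obtain ⟨⟨f, hf⟩, -⟩ := (copiesHypergraph G allTrees).isLeast_discrepancy hr hone
  let c : V → Fin r := fun v =>
    if hv : v = root then ⟨0, hr⟩ else f ⟨s(v, p v), h.adj v hv⟩
  have hc : ∀ v (hv : v ≠ root), f ⟨s(v, p v), h.adj v hv⟩ = c v := fun v hv => by
    simp [c, hv]
  let N : Finset V := Finset.univ.erase root
  have hLN : L ⊆ N := fun v hv =>
    Finset.mem_erase.2 ⟨fun e => hroot (e ▸ hv), Finset.mem_univ v⟩
  have key : ∀ j : Fin r, (r : ℤ) * ((N.filter fun v => c v = j).card : ℤ) -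
      (((N \ L).card : ℤ) + ((L.filter fun v => c v = j).card : ℤ)) ≤
        graphDiscrepancy r G allTrees := by
    intro j
    -- Parents are never in `L`, so pruning leaves keeps `W` closed under `p`.
    let W : Set V := {v | v ∉ L ∨ c v = j}
    have hW : ∀ v ∈ W, v ≠ root → p v ∈ W := fun v _ hv => Or.inl (hL v hv)
    have hle := hf.2 ⟨_, ⟨h.subgraph W hW, h.isTree_subgraph W hW (Or.inl hroot), rfl⟩, j, rfl⟩
    rw [h.imbalance_subgraph f c hc] at hle
    have e1 : {v | v ∈ W ∧ v ≠ root ∧ c v = j} = ((N.filter fun v => c v = j : Finset V) : Set V) := by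
      ext v
      simp only [W, N, Set.mem_ofPred_eq, Finset.coe_filter, Finset.mem_erase, Finset.mem_univ]
      tauto
    have e2 : {v | v ∈ W ∧ v ≠ root} =
        (((N \ L) ∪ (L.filter fun v => c v = j) : Finset V) : Set V) := by
      ext v
      have : v ∈ L → v ≠ root := fun hv e => hroot (e ▸ hv)
      simp only [W, N, Set.mem_ofPred_eq, Finset.mem_coe, Finset.mem_union, Finset.mem_sdiff,
        Finset.mem_filter, Finset.mem_erase, Finset.mem_univ]
      tauto
    have hdisj : Disjoint (N \ L) (L.filter fun v => c v = j) :=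
      Finset.disjoint_of_subset_right (Finset.filter_subset _ _) Finset.sdiff_disjoint
    rw [e1, e2, Set.ncard_coe_finset, Set.ncard_coe_finset,
      Finset.card_union_of_disjoint hdisj] at hle
    exact_mod_cast hle
  have hsum := Finset.sum_le_sum fun j (_ : j ∈ (Finset.univ : Finset (Fin r))) => key j
  have fiber : ∀ A : Finset V, ∑ j : Fin r, ((A.filter fun v => c v = j).card : ℤ) = A.card := by
    intro A
    exact_mod_cast (Finset.card_eq_sum_card_fiberwise
      (f := c) (s := A) (t := Finset.univ) (fun _ _ => Finset.mem_coe.2 (Finset.mem_univ _))).symm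
  have hcard : ((N \ L).card : ℤ) + L.card = N.card := by
    exact_mod_cast Finset.card_sdiff_add_card_eq_card hLN
  -- The total is `r * N.card - r * (N \ L).card - L.card`.
  rw [Finset.sum_sub_distrib, Finset.sum_add_distrib, ← Finset.mul_sum, fiber, fiber] at hsum
  simp only [Finset.sum_const, Finset.card_univ, Fintype.card_fin, nsmul_eq_mul] at hsum
  rw [← hcard] at hsum
  linarith

end ParentMap

/-- The parent map of the comb-like spanning tree of the grid: the backbone consists of the even
rows and the first column, the other vertices hang from the row above. -/
def gridParent {m n : ℕ} (v : Fin m × Fin n) : Fin m × Fin n :=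
  if v.1.val % 2 = 0 ∧ 0 < v.2.val then (v.1, ⟨v.2.val - 1, by omega⟩)
  -- Truncated subtraction fixes the root here.
  else (⟨v.1.val - 1, by omega⟩, v.2)

theorem isParentMap_gridParent {m n : ℕ} (hm : 0 < m) (hn : 0 < n) :
    IsParentMap (gridGraph m n) (⟨0, hm⟩, ⟨0, hn⟩) gridParent (fun v => v.1.val + v.2.val) := by
  have hne : ∀ v : Fin m × Fin n, v ≠ (⟨0, hm⟩, ⟨0, hn⟩) → 0 < v.1.val ∨ 0 < v.2.val := by
    intro v hv
    by_contra! hcon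
    exact hv (Prod.ext (Fin.ext (by simpa using hcon.1)) (Fin.ext (by simpa using hcon.2)))
  constructor
  · intro v hv
    have := hne v hv
    rw [gridGraph, SimpleGraph.boxProd_adj, SimpleGraph.pathGraph_adj, SimpleGraph.pathGraph_adj]
    unfold gridParent
    split_ifs with hcase
    · exact Or.inr ⟨Or.inr (by dsimp only; omega), rfl⟩
    · exact Or.inl ⟨Or.inr (by dsimp only; omega), rfl⟩
  · intro v hv
    have := hne v hv
    unfold gridParent
    split_ifs with hcase <;> dsimp only <;> omega

/-- The leaves of the comb-like spanning tree: the vertices in the odd rows outside the first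
column. -/
def gridLeaves (m n : ℕ) : Finset (Fin m × Fin n) :=
  (Finset.univ.filter fun i : Fin m => i.val % 2 = 1) ×ˢ
    (Finset.univ.filter fun j : Fin n => 0 < j.val)

theorem gridParent_notMem_gridLeaves {m n : ℕ} (v : Fin m × Fin n) :
    gridParent v ∉ gridLeaves m n := by
  simp only [gridLeaves, Finset.mem_product, Finset.mem_filter, Finset.mem_univ, true_and]
  unfold gridParent
  split_ifs with hcase <;> dsimp only <;> omega

theorem le_card_gridLeaves (m n : ℕ) : (m / 2) * (n - 1) ≤ (gridLeaves m n).card := by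
  rw [gridLeaves, Finset.card_product]
  refine Nat.mul_le_mul ?_ ?_
  · have hcard : Fintype.card (Fin (m / 2)) ≤ _ := Finset.card_le_card_of_injOn
      (s := Finset.univ) (t := Finset.univ.filter fun i : Fin m => i.val % 2 = 1)
      (fun k : Fin (m / 2) => (⟨2 * k.val + 1, by omega⟩ : Fin m))
      (fun k _ => by simp) (fun a _ b _ hab => by simpa [Fin.ext_iff] using hab)
    simpa using hcard
  · have hcard : Fintype.card (Fin (n - 1)) ≤ _ := Finset.card_le_card_of_injOn
      (s := Finset.univ) (t := Finset.univ.filter fun j : Fin n => 0 < j.val)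
      (fun k : Fin (n - 1) => (⟨k.val + 1, by omega⟩ : Fin n))
      (fun k _ => by simp) (fun a _ b _ hab => by simpa [Fin.ext_iff] using hab)
    simpa using hcard

theorem corollary1p2 (r m n : ℕ) (hr : 2 ≤ r) (hm : 2 ≤ m) (hn : 2 ≤ n) :
    ((r : ℝ) - 1) / (4 * (r : ℝ)) * ((m : ℝ) * (n : ℝ)) + 1 - 2 * (r : ℝ) ≤
      ((graphDiscrepancy r (gridGraph m n) allTrees : ℤ) : ℝ) := by
  have hmain := (isParentMap_gridParent (m := m) (n := n) (by omega) (by omega)).mul_card_leaves_le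
    (r := r) (by omega) (gridLeaves m n) (by simp [gridLeaves])
    (fun v _ => gridParent_notMem_gridLeaves v)
  generalize graphDiscrepancy r (gridGraph m n) allTrees = D at hmain ⊢
  have hmainR : ((r : ℝ) - 1) * ((gridLeaves m n).card : ℝ) ≤ r * (D : ℝ) := by
    exact_mod_cast hmain
  have hrR : (2 : ℝ) ≤ r := by exact_mod_cast hr
  have hmR : (2 : ℝ) ≤ m := by exact_mod_cast hm
  have hnR : (2 : ℝ) ≤ n := by exact_mod_cast hn
  have hhalf : (m : ℝ) - 1 ≤ 2 * ((m / 2 : ℕ) : ℝ) := by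
    have : m ≤ 2 * (m / 2) + 1 := by omega
    have : (m : ℝ) ≤ 2 * ((m / 2 : ℕ) : ℝ) + 1 := by exact_mod_cast this
    linarith
  have hleaf : ((m / 2 : ℕ) : ℝ) * ((n : ℝ) - 1) ≤ ((gridLeaves m n).card : ℝ) := by
    have := le_card_gridLeaves m n
    have hcast : (((m / 2) * (n - 1) : ℕ) : ℝ) ≤ ((gridLeaves m n).card : ℝ) := by
      exact_mod_cast this
    rwa [Nat.cast_mul, Nat.cast_sub (by omega : 1 ≤ n), Nat.cast_one] at hcast
  have hquarter : (m : ℝ) * n / 4 - 1 ≤ ((gridLeaves m n).card : ℝ) := by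
    have h1 := mul_le_mul_of_nonneg_right hhalf (by linarith : (0 : ℝ) ≤ (n : ℝ) - 1)
    -- `(m - 1)(n - 1) / 2 - (mn / 4 - 1) = ((m - 2)(n - 2) + 2) / 4`.
    have h2 := mul_nonneg (sub_nonneg.2 hmR) (sub_nonneg.2 hnR)
    linarith
  -- The slack is `2r - 1 - 2r² = -(r² + (r - 1)²) < 0`.
  have h3 := mul_le_mul_of_nonneg_left hquarter (by linarith : (0 : ℝ) ≤ (r : ℝ) - 1)
  have hr0 : (0 : ℝ) < r := by linarith
  have h4 : (r : ℝ) * (((r : ℝ) - 1) / (4 * r) * (m * n) + 1 - 2 * r) =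
      ((r : ℝ) - 1) * (m * n / 4 - 1) + (2 * r - 1 - 2 * r ^ 2) := by
    field_simp
    ring
  refine le_of_mul_le_mul_left ?_ hr0
  rw [h4]
  nlinarith
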